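/- Let $d\ge 0$ and $s\ge 1$ be integers, let $x^*y$ be the standard Hermitian form on $\mathbb{C}^d$, and let $\Omega=\{z\in\mathbb{C}^d : z^*z=1\}$ be the unit sphere with its unitarily invariant probability measure $\omega$ (normalized surface measure). For integers $k,l\ge 0$ let $\mathrm{Hom}(k,l)$ be the complex vector space of polynomial functions $f:\mathbb{C}^d\to\mathbb{C}$ that are homogeneous of degree $k$ in the coordinates $z_1,\dots,z_d$ and homogeneous of degree $l$ in their conjugates $\bar z_1,\dots,\bar z_d$. A set of lines in $\mathbb{C}^d$ is given by a set $X\subseteq\Omega$ of unit vectors such that distinct vectors of $X$ span distinct complex lines. The degree set of $X$ is $A=\{|x^*y|^2 : x,y\in X,\ x\ne y\}$. The set $X$ is an $s$-distance set if $|A|=s$. It is a $t$-design if $X$ is finite and for every $f\in\mathrm{Hom}(t,t)$ $$\frac1{|X|}\sum_{z\in X} f(z)=\int_\Omega f(z)\,d\omega(z).$$ Let $X$ be a set of lines in $\mathbb{C}^d$ whose degree set contains $0$. Then any two of the following conditions imply the third: (a) $X$ is an $s$-distance set; (b) $X$ is a $(2s-1)$-design; (c) $|X|=\dim \mathrm{Hom}(s,s-1)$.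 -/

import Mathlib

open MeasureTheory

noncomputable section

namespace ComplexLines

/-- The Hermitian space `ℂ^d`; `inner ℂ x y` is `x^* y`, conjugate-linear in `x`. -/
abbrev CSpace (d : ℕ) : Type := EuclideanSpace ℂ (Fin d)

/-- The unit sphere `Ω` in `ℂ^d`. -/
abbrev Omega (d : ℕ) : Set (CSpace d) := Metric.sphere (0 : CSpace d) 1

/-- Formal polynomials in variables `z_1, …, z_d` (left summand) and `zbar_1, …, zbar_d`
(right summand). They are evaluated at `z ∈ ℂ^d` by substituting `z_i` for the `i`-th left
variable and the complex conjugate of `z_i` for the `i`-th right variable. -/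
def evalConj (d : ℕ) : MvPolynomial (Fin d ⊕ Fin d) ℂ →ₗ[ℂ] (CSpace d → ℂ) :=
  LinearMap.pi fun z =>
    (MvPolynomial.aeval
      (Sum.elim (fun i => z i) (fun i => (starRingEnd ℂ) (z i)))).toLinearMap

/-- Formal polynomials that are homogeneous of degree `k` in the `z_i` and homogeneous of
degree `l` in the `zbar_i`. -/
def bihomogeneous (d k l : ℕ) : Submodule ℂ (MvPolynomial (Fin d ⊕ Fin d) ℂ) :=
  MvPolynomial.weightedHomogeneousSubmodule ℂ (Sum.elim (fun _ => 1) (fun _ => 0)) k ⊓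
    MvPolynomial.weightedHomogeneousSubmodule ℂ (Sum.elim (fun _ => 0) (fun _ => 1)) l

/-- `Hom(k,l)`: the complex vector space of polynomial functions `ℂ^d → ℂ` that are
homogeneous of degree `k` in the coordinates of `z` and homogeneous of degree `l` in their
complex conjugates. -/
def HomPoly (d k l : ℕ) : Submodule ℂ (CSpace d → ℂ) :=
  (bihomogeneous d k l).map (evalConj d)

/-- The invariant probability measure `ω` on the unit sphere `Ω`: surface measure (the
spherical part of Lebesgue measure on `ℂ^d` in polar coordinates), normalized to total mass
one. -/
def omega (d : ℕ) : Measure (Omega d) :=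
  ((volume : Measure (CSpace d)).toSphere Set.univ)⁻¹ • (volume : Measure (CSpace d)).toSphere

/-- A set of lines in `ℂ^d`, given by unit vectors spanning them; each line occurs once. -/
def IsLineSet {d : ℕ} (X : Set (CSpace d)) : Prop :=
  X ⊆ Omega d ∧ X.InjOn fun x => Submodule.span ℂ {x}

/-- The degree set of `X`: all values `|x^* y|^2` for distinct `x, y ∈ X`. -/
def degreeSet {d : ℕ} (X : Set (CSpace d)) : Set ℝ :=
  {α | ∃ x ∈ X, ∃ y ∈ X, x ≠ y ∧ ‖inner ℂ x y‖ ^ 2 = α}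

/-- `X` is an `s`-distance set: its degree set has exactly `s` elements. -/
def IsDistanceSet {d : ℕ} (s : ℕ) (X : Set (CSpace d)) : Prop :=
  (degreeSet X).encard = s

/-- `X` is a `t`-design: it is finite, and every `f ∈ Hom(t,t)` has the same average over `X`
as over the unit sphere. -/
def IsDesign {d : ℕ} (t : ℕ) (X : Set (CSpace d)) : Prop :=
  ∃ hX : X.Finite, ∀ f ∈ HomPoly d t t,
    (1 / (hX.toFinset.card : ℂ)) * ∑ x ∈ hX.toFinset, f x = ∫ z : Omega d, f z ∂(omega d)

end ComplexLines

end

open MeasureTheory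

noncomputable section

namespace ComplexLines

variable {d : ℕ}

/-! Write s = m + 1, V = Hom(m+1, m), and consider the evaluation map from V to the functions on X.
Since Hom(2m+1, 2m+1) is spanned by the products conj(f) g with f, g in V, being a (2m+1)-design
means that evaluation preserves the L² inner product of the sphere up to the factor |X|
(`isDesign_iff_sphereInner`). Hence a design makes evaluation injective.

If X has m nonzero degrees α, then F_x(y) = x^*y ∏ (|x^*y|² - α y^*y) lies in V and vanishes on X
exactly away from x, so evaluation is surjective. Both facts together give |X| = dim V.

With (a) and (c), evaluation is bijective and the F_x form a basis. Let K be the reproducing kernel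
of V. The squared norms of K_x - (|X|/c) F_x, with c = F_x(x), sum to 0 over X, so F_x is a multiple
of K_x. The expansion of g in V along the F_x is then the design identity
(`isDesign_of_annihilator`).

With (b) and (c), K_x is |X| times the delta function of x on X. By unitary invariance, the nonzero
degrees are then roots of one polynomial of degree at most m (`encard_degreeSet_le_of_isDesign`).
Fewer than m nonzero degrees would produce a nonzero element of V vanishing on X
(`le_card_of_isDesign`). -/

/-! ### Bihomogeneous polynomial functions. -/

/-- The space of functions spanned by the coordinates. -/
def coordSpan (d : ℕ) : Submodule ℂ (CSpace d → ℂ) :=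
  Submodule.span ℂ (Set.range fun (i : Fin d) (z : CSpace d) => z i)

/-- The space of functions spanned by the conjugates of the coordinates. -/
def conjCoordSpan (d : ℕ) : Submodule ℂ (CSpace d → ℂ) :=
  Submodule.span ℂ (Set.range fun (i : Fin d) (z : CSpace d) => (starRingEnd ℂ) (z i))


theorem coord_mem_coordSpan (i : Fin d) : (fun z : CSpace d => z i) ∈ coordSpan d :=
  Submodule.subset_span ⟨i, rfl⟩

theorem conj_coord_mem_conjCoordSpan (i : Fin d) :
    (fun z : CSpace d => (starRingEnd ℂ) (z i)) ∈ conjCoordSpan d :=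
  Submodule.subset_span ⟨i, rfl⟩

theorem evalConj_mul (p q : MvPolynomial (Fin d ⊕ Fin d) ℂ) :
    evalConj d (p * q) = evalConj d p * evalConj d q := by
  ext z; simp [evalConj]

theorem evalConj_monomial_mem (m : (Fin d ⊕ Fin d) →₀ ℕ) :
    evalConj d (MvPolynomial.monomial m 1) ∈
      coordSpan d ^ (Finsupp.weight (Sum.elim (fun _ => 1) (fun _ => 0)) m : ℕ) *
      conjCoordSpan d ^ (Finsupp.weight (Sum.elim (fun _ => 0) (fun _ => 1)) m : ℕ) := by
  induction m using Finsupp.induction_linear with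
  | zero =>
    simp only [map_zero, pow_zero, one_mul]
    refine Submodule.mem_one.2 ⟨1, ?_⟩
    ext z; simp [evalConj]
  | add f g hf hg =>
    have := Submodule.mul_mem_mul hf hg
    rw [← evalConj_mul, MvPolynomial.monomial_mul, one_mul] at this
    rw [map_add, map_add, pow_add, pow_add]
    convert this using 1
    ring
  | single i n =>
    have h : evalConj d (MvPolynomial.monomial (Finsupp.single i n) 1)
        = (evalConj d (MvPolynomial.X i)) ^ n := by
      ext z; simp [evalConj, MvPolynomial.aeval_monomial]
    rw [h]
    rcases i with i | i
    · simp only [Finsupp.weight_single, Sum.elim_inl, smul_eq_mul, mul_one, mul_zero, pow_zero]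
      convert Submodule.pow_mem_pow _ (coord_mem_coordSpan i) n using 2
      ext z; simp [evalConj]
    · simp only [Finsupp.weight_single, Sum.elim_inr, smul_eq_mul, mul_one, mul_zero, pow_zero,
        one_mul]
      convert Submodule.pow_mem_pow _ (conj_coord_mem_conjCoordSpan i) n using 2
      ext z; simp [evalConj]

theorem homPoly_mul_le (k l k' l' : ℕ) :
    HomPoly d k l * HomPoly d k' l' ≤ HomPoly d (k + k') (l + l') := by
  rw [Submodule.mul_le]
  rintro _ ⟨p, ⟨hp, hp'⟩, rfl⟩ _ ⟨q, ⟨hq, hq'⟩, rfl⟩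
  exact ⟨p * q, ⟨MvPolynomial.IsWeightedHomogeneous.mul hp hq,
    MvPolynomial.IsWeightedHomogeneous.mul hp' hq'⟩, evalConj_mul p q⟩

theorem one_le_homPoly : 1 ≤ HomPoly d 0 0 := by
  rw [Submodule.one_le]
  exact ⟨1, ⟨MvPolynomial.isWeightedHomogeneous_one _ _,
    MvPolynomial.isWeightedHomogeneous_one _ _⟩, by ext z; simp [evalConj]⟩

theorem coordSpan_pow_le (k : ℕ) : coordSpan d ^ k ≤ HomPoly d k 0 := by
  induction k with
  | zero => simpa using one_le_homPoly
  | succ k ih =>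
    rw [pow_succ]
    refine (mul_le_mul' ih (?_ : _ ≤ HomPoly d 1 0)).trans (homPoly_mul_le k 0 1 0)
    rw [coordSpan, Submodule.span_le]
    rintro _ ⟨i, rfl⟩
    exact ⟨MvPolynomial.X (Sum.inl i), ⟨MvPolynomial.isWeightedHomogeneous_X _ _ _,
      MvPolynomial.isWeightedHomogeneous_X _ _ _⟩, by ext z; simp [evalConj]⟩

theorem conjCoordSpan_pow_le (l : ℕ) : conjCoordSpan d ^ l ≤ HomPoly d 0 l := by
  induction l with
  | zero => simpa using one_le_homPoly
  | succ l ih =>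
    rw [pow_succ]
    refine (mul_le_mul' ih (?_ : _ ≤ HomPoly d 0 1)).trans (homPoly_mul_le 0 l 0 1)
    rw [conjCoordSpan, Submodule.span_le]
    rintro _ ⟨i, rfl⟩
    exact ⟨MvPolynomial.X (Sum.inr i), ⟨MvPolynomial.isWeightedHomogeneous_X _ _ _,
      MvPolynomial.isWeightedHomogeneous_X _ _ _⟩, by ext z; simp [evalConj]⟩

/-- A bihomogeneous monomial is a product of k coordinates and l conjugates. In this form
multiplicativity and finite dimension are formal. -/
theorem homPoly_eq (d k l : ℕ) : HomPoly d k l = coordSpan d ^ k * conjCoordSpan d ^ l := by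
  apply le_antisymm
  · rintro _ ⟨p, ⟨hp, hp'⟩, rfl⟩
    rw [p.as_sum, map_sum]
    refine Submodule.sum_mem _ fun m hm => ?_
    have hc := MvPolynomial.mem_support_iff.1 hm
    have h := evalConj_monomial_mem m
    rw [hp hc, hp' hc] at h
    have := Submodule.smul_mem _ (p.coeff m) h
    rwa [← map_smul, MvPolynomial.smul_monomial, smul_eq_mul, mul_one] at this
  · simpa using (mul_le_mul' (coordSpan_pow_le k) (conjCoordSpan_pow_le l)).trans
      (homPoly_mul_le k 0 0 l)

theorem homPoly_mul (k l k' l' : ℕ) :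
    HomPoly d k l * HomPoly d k' l' = HomPoly d (k + k') (l + l') := by
  simp only [homPoly_eq]; ring

theorem mul_mem_homPoly {k l k' l' : ℕ} {f g : CSpace d → ℂ} (hf : f ∈ HomPoly d k l)
    (hg : g ∈ HomPoly d k' l') : f * g ∈ HomPoly d (k + k') (l + l') :=
  homPoly_mul_le _ _ _ _ (Submodule.mul_mem_mul hf hg)

instance finite_homPoly (d k l : ℕ) : Module.Finite ℂ (HomPoly d k l) := by
  rw [homPoly_eq]
  exact Module.Finite.iff_fg.2 (((Submodule.fg_span (Set.finite_range _)).pow k).mul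
    ((Submodule.fg_span (Set.finite_range _)).pow l))

/-- The induction principle behind conjugation, substitution, scaling, continuity and restriction to
planes. -/
theorem homPoly_le_of_closed {p : ℕ → ℕ → Submodule ℂ (CSpace d → ℂ)} (one : 1 ∈ p 0 0)
    (coord : ∀ i k l, ∀ f ∈ p k l, (fun z => z i) * f ∈ p (k + 1) l)
    (conj : ∀ i k l, ∀ f ∈ p k l, (fun z => (starRingEnd ℂ) (z i)) * f ∈ p k (l + 1))
    (k l : ℕ) : HomPoly d k l ≤ p k l := by
  rw [homPoly_eq]
  induction k with
  | zero =>
    rw [pow_zero, one_mul]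
    induction l with
    | zero => rwa [pow_zero, Submodule.one_le]
    | succ l ih =>
      rw [pow_succ']
      refine (mul_le_mul_right ih _).trans ?_
      rw [conjCoordSpan, ← (p 0 l).span_eq, Submodule.span_mul_span, Submodule.span_le,
        Set.mul_subset_iff]
      rintro _ ⟨i, rfl⟩ f hf
      exact conj i 0 l f hf
  | succ k ih =>
    rw [pow_succ', mul_assoc]
    refine (mul_le_mul_right ih _).trans ?_
    rw [coordSpan, ← (p k l).span_eq, Submodule.span_mul_span, Submodule.span_le,
      Set.mul_subset_iff]
    rintro _ ⟨i, rfl⟩ f hf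
    exact coord i k l f hf

theorem one_mem_homPoly : (1 : CSpace d → ℂ) ∈ HomPoly d 0 0 := Submodule.one_le.1 one_le_homPoly

theorem coord_mem_homPoly (i : Fin d) : (fun z : CSpace d => z i) ∈ HomPoly d 1 0 :=
  coordSpan_pow_le 1 (by rw [pow_one]; exact coord_mem_coordSpan i)

theorem conj_coord_mem_homPoly (i : Fin d) :
    (fun z : CSpace d => (starRingEnd ℂ) (z i)) ∈ HomPoly d 0 1 :=
  conjCoordSpan_pow_le 1 (by rw [pow_one]; exact conj_coord_mem_conjCoordSpan i)

theorem star_mem_homPoly {k l : ℕ} {f : CSpace d → ℂ} (hf : f ∈ HomPoly d k l) :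
    star f ∈ HomPoly d l k := by
  refine homPoly_le_of_closed (p := fun k l => (HomPoly d l k).comap
    (starLinearEquiv ℂ : (CSpace d → ℂ) ≃ₗ⋆[ℂ] (CSpace d → ℂ)).toLinearMap) ?_ ?_ ?_ k l hf
  · simpa using one_mem_homPoly
  · intro i k l f hf
    have := mul_mem_homPoly (conj_coord_mem_homPoly i) (Submodule.mem_comap.1 hf)
    rw [zero_add, add_comm] at this
    rw [Submodule.mem_comap]
    convert this using 1
    ext z; simp
  · intro i k l f hf
    have := mul_mem_homPoly (coord_mem_homPoly i) (Submodule.mem_comap.1 hf)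
    rw [zero_add, add_comm] at this
    rw [Submodule.mem_comap]
    convert this using 1
    ext z; simp

theorem linear_mem_homPoly (φ : CSpace d →ₗ[ℂ] ℂ) : (φ : CSpace d → ℂ) ∈ HomPoly d 1 0 := by
  have : (φ : CSpace d → ℂ) = ∑ i, φ (EuclideanSpace.basisFun (Fin d) ℂ i) • fun z => z i := by
    ext z
    conv_lhs => rw [← (EuclideanSpace.basisFun (Fin d) ℂ).sum_repr z]
    simp [mul_comm]
  rw [this]
  exact Submodule.sum_mem _ fun i _ => Submodule.smul_mem _ _ (coord_mem_homPoly i)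

theorem inner_mem_homPoly (x : CSpace d) : (fun y => inner ℂ x y) ∈ HomPoly d 1 0 :=
  linear_mem_homPoly (innerSL ℂ x).toLinearMap

theorem inner_mem_homPoly' (x : CSpace d) : (fun y => inner ℂ y x) ∈ HomPoly d 0 1 := by
  convert star_mem_homPoly (inner_mem_homPoly x) using 1
  ext y; simp

theorem norm_inner_sq_mem_homPoly (x : CSpace d) :
    (fun y => ((‖inner ℂ x y‖ ^ 2 : ℝ) : ℂ)) ∈ HomPoly d 1 1 := by
  convert mul_mem_homPoly (inner_mem_homPoly x) (inner_mem_homPoly' x) using 1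
  ext y
  rw [Pi.mul_apply, ← inner_conj_symm y x, Complex.mul_conj, Complex.normSq_eq_norm_sq]

theorem norm_sq_mem_homPoly : (fun y : CSpace d => ((‖y‖ ^ 2 : ℝ) : ℂ)) ∈ HomPoly d 1 1 := by
  have : (fun y : CSpace d => ((‖y‖ ^ 2 : ℝ) : ℂ)) =
      ∑ i, (fun z : CSpace d => z i) * (fun z => (starRingEnd ℂ) (z i)) := by
    ext y
    simp [EuclideanSpace.norm_sq_eq, Complex.mul_conj, Complex.normSq_eq_norm_sq]
  rw [this]
  exact Submodule.sum_mem _ fun i _ =>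
    by simpa using mul_mem_homPoly (coord_mem_homPoly i) (conj_coord_mem_homPoly i)

theorem pow_mem_homPoly {k l : ℕ} {f : CSpace d → ℂ} (hf : f ∈ HomPoly d k l) (n : ℕ) :
    f ^ n ∈ HomPoly d (n * k) (n * l) := by
  induction n with
  | zero => simpa using one_mem_homPoly
  | succ n ih => rw [pow_succ, add_one_mul, add_one_mul]; exact mul_mem_homPoly ih hf

theorem prod_mem_homPoly {ι : Type*} (t : Finset ι) {f : ι → CSpace d → ℂ} {k l : ℕ}
    (hf : ∀ i ∈ t, f i ∈ HomPoly d k l) : ∏ i ∈ t, f i ∈ HomPoly d (t.card * k) (t.card * l) := by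
  classical
  induction t using Finset.induction_on with
  | empty => simpa using one_mem_homPoly
  | insert a t ha ih =>
    rw [Finset.prod_insert ha, Finset.card_insert_of_notMem ha, add_comm, add_mul, add_mul,
      one_mul, one_mul]
    exact mul_mem_homPoly (hf a (Finset.mem_insert_self a t))
      (ih fun i hi => hf i (Finset.mem_insert_of_mem hi))

theorem comp_mem_homPoly {k l : ℕ} {f : CSpace d → ℂ} (hf : f ∈ HomPoly d k l)
    (g : CSpace d →ₗ[ℂ] CSpace d) : f ∘ g ∈ HomPoly d k l := by
  have hφ (i : Fin d) : (fun z => g z i) ∈ HomPoly d 1 0 :=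
    linear_mem_homPoly ((EuclideanSpace.proj i : CSpace d →L[ℂ] ℂ).toLinearMap ∘ₗ g)
  refine homPoly_le_of_closed (p := fun k l => (HomPoly d k l).comap
    (LinearMap.funLeft ℂ ℂ g)) ?_ ?_ ?_ k l hf
  · exact one_mem_homPoly
  · intro i k l f hf
    have := mul_mem_homPoly (hφ i) (Submodule.mem_comap.1 hf)
    rwa [zero_add, add_comm] at this
  · intro i k l f hf
    have := mul_mem_homPoly (star_mem_homPoly (hφ i)) (Submodule.mem_comap.1 hf)
    rwa [zero_add, add_comm] at this

theorem homPoly_smul_apply {k l : ℕ} {f : CSpace d → ℂ} (hf : f ∈ HomPoly d k l) (c : ℂ)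
    (z : CSpace d) : f (c • z) = c ^ k * (starRingEnd ℂ) c ^ l * f z := by
  let p (k l : ℕ) : Submodule ℂ (CSpace d → ℂ) :=
    { carrier := {f | ∀ z, f (c • z) = c ^ k * (starRingEnd ℂ) c ^ l * f z}
      zero_mem' := by simp
      add_mem' := fun hf hg z => by simp only [Pi.add_apply, hf z, hg z]; ring
      smul_mem' := fun a f hf z => by simp only [Pi.smul_apply, hf z, smul_eq_mul]; ring }
  refine homPoly_le_of_closed (p := p) ?_ ?_ ?_ k l hf z
  · intro z; simp
  · intro i k l f hf z
    simp only [Pi.mul_apply, hf z, PiLp.smul_apply, smul_eq_mul]; ring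
  · intro i k l f hf z
    simp only [Pi.mul_apply, hf z, PiLp.smul_apply, smul_eq_mul, map_mul]; ring

theorem continuous_of_mem_homPoly {k l : ℕ} {f : CSpace d → ℂ} (hf : f ∈ HomPoly d k l) :
    Continuous f := by
  let p (_ _ : ℕ) : Submodule ℂ (CSpace d → ℂ) :=
    { carrier := {f | Continuous f}
      zero_mem' := continuous_zero
      add_mem' := Continuous.add
      smul_mem' := fun a f hf => Continuous.const_smul hf a }
  refine homPoly_le_of_closed (p := p) continuous_one ?_ ?_ k l hf
  · intro i k l f hf
    exact Continuous.mul (by fun_prop) hf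
  · intro i k l f hf
    exact Continuous.mul (Complex.continuous_conj.comp (by fun_prop)) hf

theorem eq_zero_of_eqOn_sphere [NeZero d] {k l : ℕ} {f : CSpace d → ℂ} (hf : f ∈ HomPoly d k l)
    (h : ∀ z ∈ Omega d, f z = 0) : f = 0 := by
  obtain ⟨e, he⟩ := exists_norm_eq (CSpace d) (zero_le_one' ℝ)
  have hmem (z : CSpace d) : ∃ w ∈ Omega d, z = ((‖z‖ : ℝ) : ℂ) • w := by
    by_cases hz : z = 0
    -- At the origin any unit vector serves; for k = l = 0 the convention 0 ^ 0 = 1 gives f(0) =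
    -- f(e).
    · exact ⟨e, by simp [he], by simp [hz]⟩
    · have hz' : ((‖z‖ : ℝ) : ℂ) ≠ 0 := by simpa using hz
      refine ⟨((‖z‖ : ℝ) : ℂ)⁻¹ • z, ?_, by rw [smul_smul, mul_inv_cancel₀ hz', one_smul]⟩
      simp [norm_smul, hz]
  ext z
  obtain ⟨w, hw, hzw⟩ := hmem z
  rw [hzw, homPoly_smul_apply hf, h w hw, mul_zero, Pi.zero_apply]

/-! ### The invariant measure and the unitary group. -/

instance isProbabilityMeasure_omega [NeZero d] : IsProbabilityMeasure (omega d) := by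
  have h : (volume : Measure (CSpace d)).toSphere ≠ 0 := Measure.toSphere_ne_zero _
  refine ⟨?_⟩
  rw [omega, Measure.smul_apply, smul_eq_mul]
  exact ENNReal.inv_mul_cancel (Measure.measure_univ_ne_zero.2 h) (measure_ne_top _ _)

instance isOpenPosMeasure_omega : (omega d).IsOpenPosMeasure :=
  Measure.isOpenPosMeasure_smul _ (ENNReal.inv_ne_zero.2 (measure_ne_top _ _))

/-- The homeomorphism of the unit sphere induced by a unitary map. -/
def sphereHomeomorph (g : CSpace d ≃ₗᵢ[ℂ] CSpace d) : Omega d ≃ₜ Omega d :=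
  g.toHomeomorph.subtype fun z => by simp

open scoped Pointwise in
-- Surface measure of s is, up to a constant, the volume of the cone over s. Cones commute with g,
-- and a linear isometry preserves volume.
theorem measurePreserving_sphereHomeomorph (g : CSpace d ≃ₗᵢ[ℂ] CSpace d) :
    MeasurePreserving (sphereHomeomorph g).toMeasurableEquiv (omega d) (omega d) := by
  refine MeasurePreserving.smul_measure ⟨MeasurableEquiv.measurable _, ?_⟩ _
  ext s hs
  rw [MeasurableEquiv.map_apply, Measure.toSphere_apply' _ hs,
    Measure.toSphere_apply' _ (MeasurableEquiv.measurable _ hs)]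
  have hg : MeasurePreserving g volume volume :=
    LinearIsometryEquiv.measurePreserving (E := CSpace d) (F := CSpace d)
      { toLinearEquiv := g.toLinearEquiv.restrictScalars ℝ, norm_map' := g.norm_map }
  rw [← hg.measure_preimage_equiv (f := g.toHomeomorph.toMeasurableEquiv)
    (Set.Ioo (0 : ℝ) 1 • Subtype.val '' s)]
  congr 2
  ext z
  simp only [Set.mem_smul, Set.mem_image, Set.mem_preimage]
  constructor
  · rintro ⟨r, hr, _, ⟨w, hw, rfl⟩, rfl⟩
    refine ⟨r, hr, _, ⟨_, hw, rfl⟩, ?_⟩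
    exact ((g.toLinearEquiv.restrictScalars ℝ).map_smul r (w : CSpace d)).symm
  · rintro ⟨r, hr, _, ⟨w, hw, rfl⟩, h⟩
    refine ⟨r, hr, _, ⟨(sphereHomeomorph g).symm w, ?_, rfl⟩, ?_⟩
    · simpa using hw
    · apply g.injective
      refine Eq.trans ?_ h
      refine ((g.toLinearEquiv.restrictScalars ℝ).map_smul r _).trans ?_
      change r • (sphereHomeomorph g ((sphereHomeomorph g).symm w) : CSpace d) = _
      rw [Homeomorph.apply_symm_apply]

theorem integral_omega_comp (g : CSpace d ≃ₗᵢ[ℂ] CSpace d) (f : CSpace d → ℂ) :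
    ∫ z : Omega d, f (g z) ∂(omega d) = ∫ z : Omega d, f z ∂(omega d) :=
  (measurePreserving_sphereHomeomorph g).integral_comp' (g := fun z : Omega d => f z)

theorem two_le_of_orthogonal {x x' : CSpace d} (hx : ‖x‖ = 1) (hx' : ‖x'‖ = 1)
    (h : inner ℂ x x' = 0) : 2 ≤ d := by
  have h' : inner ℂ x' x = 0 := inner_eq_zero_symm.1 h
  have ho : Orthonormal ℂ ![x, x'] := by
    refine ⟨fun i => by fin_cases i <;> simp [hx, hx'], fun i j hij => ?_⟩
    fin_cases i <;> fin_cases j <;> simp_all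
  simpa using ho.linearIndependent.fintype_card_le_finrank

theorem exists_linearIsometryEquiv_pair {x x' y y' : CSpace d} (hx : ‖x‖ = 1) (hx' : ‖x'‖ = 1)
    (hxx' : inner ℂ x x' = 0) (hy : ‖y‖ = 1) (hy' : ‖y'‖ = 1) (hyy' : inner ℂ y y' = 0) :
    ∃ g : CSpace d ≃ₗᵢ[ℂ] CSpace d, g x = y ∧ g x' = y' := by
  have hd : 2 ≤ d := two_le_of_orthogonal hx hx' hxx'
  have ext (x x' : CSpace d) (hx : ‖x‖ = 1) (hx' : ‖x'‖ = 1) (h : inner ℂ x x' = 0) :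
      ∃ b : OrthonormalBasis (Fin d) ℂ (CSpace d), b ⟨0, by omega⟩ = x ∧ b ⟨1, by omega⟩ = x' := by
    have h' : inner ℂ x' x = 0 := inner_eq_zero_symm.1 h
    let v : Fin d → CSpace d := fun i => if i.1 = 0 then x else x'
    have hv : Orthonormal ℂ (({⟨0, by omega⟩, ⟨1, by omega⟩} : Set (Fin d)).domRestrict v) := by
      constructor
      · rintro ⟨i, rfl | rfl⟩ <;> simp [v, hx, hx']
      · rintro ⟨i, rfl | rfl⟩ ⟨j, rfl | rfl⟩ hij <;> simp_all [v]
    obtain ⟨b, hb⟩ := hv.exists_orthonormalBasis_extension_of_card_eq (by simp)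
    exact ⟨b, by simpa [v] using hb ⟨0, by omega⟩ (by simp),
      by simpa [v] using hb ⟨1, by omega⟩ (by simp)⟩
  obtain ⟨b, hb0, hb1⟩ := ext x x' hx hx' hxx'
  obtain ⟨c, hc0, hc1⟩ := ext y y' hy hy' hyy'
  refine ⟨b.equiv c (Equiv.refl _), ?_, ?_⟩
  · rw [← hb0, ← hc0, OrthonormalBasis.equiv_apply_basis]; rfl
  · rw [← hb1, ← hc1, OrthonormalBasis.equiv_apply_basis]; rfl

/-! ### The L² inner product on the sphere. -/

section

/-- The inner product of `L²(Ω)`, conjugate-linear in the first variable. -/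
def sphereInner (f g : CSpace d → ℂ) : ℂ :=
  ∫ z : Omega d, (starRingEnd ℂ) (f z) * g z ∂(omega d)

theorem sphereInner_conj_symm (f g : CSpace d → ℂ) :
    (starRingEnd ℂ) (sphereInner g f) = sphereInner f g := by
  rw [sphereInner, ← integral_conj]
  simp [sphereInner, mul_comm]

theorem sphereInner_smul_right (c : ℂ) (f g : CSpace d → ℂ) :
    sphereInner f (c • g) = c * sphereInner f g := by
  rw [sphereInner, sphereInner, ← integral_const_mul]
  simp [mul_left_comm]

theorem sphereInner_smul_left (c : ℂ) (f g : CSpace d → ℂ) :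
    sphereInner (c • f) g = (starRingEnd ℂ) c * sphereInner f g := by
  rw [sphereInner, sphereInner, ← integral_const_mul]
  simp [mul_assoc]

theorem sphereInner_self (f : CSpace d → ℂ) :
    sphereInner f f = ((∫ z : Omega d, ‖f z‖ ^ 2 ∂(omega d) : ℝ) : ℂ) := by
  rw [sphereInner, ← integral_complex_ofReal]
  congr 1; ext z
  rw [mul_comm, Complex.mul_conj, Complex.normSq_eq_norm_sq]

variable [NeZero d]

theorem integrable_omega {f : CSpace d → ℂ} (hf : Continuous f) :
    Integrable (fun z : Omega d => f z) (omega d) :=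
  (hf.comp continuous_subtype_val).integrable_of_hasCompactSupport
    (HasCompactSupport.of_compactSpace _)

theorem integrable_star_mul {f g : CSpace d → ℂ} (hf : Continuous f) (hg : Continuous g) :
    Integrable (fun z : Omega d => (starRingEnd ℂ) (f z) * g z) (omega d) :=
  integrable_omega ((Complex.continuous_conj.comp hf).mul hg)

theorem sphereInner_add_right {f g h : CSpace d → ℂ} (hf : Continuous f) (hg : Continuous g)
    (hh : Continuous h) : sphereInner f (g + h) = sphereInner f g + sphereInner f h := by
  rw [sphereInner, sphereInner, sphereInner,
    ← integral_add (integrable_star_mul hf hg) (integrable_star_mul hf hh)]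
  simp [mul_add]

theorem sphereInner_add_left {f g h : CSpace d → ℂ} (hf : Continuous f) (hg : Continuous g)
    (hh : Continuous h) : sphereInner (f + g) h = sphereInner f h + sphereInner g h := by
  rw [← sphereInner_conj_symm, sphereInner_add_right hh hf hg, map_add, sphereInner_conj_symm,
    sphereInner_conj_symm]

theorem sphereInner_sub_right {f g h : CSpace d → ℂ} (hf : Continuous f) (hg : Continuous g)
    (hh : Continuous h) : sphereInner f (g - h) = sphereInner f g - sphereInner f h := by
  rw [sphereInner, sphereInner, sphereInner,
    ← integral_sub (integrable_star_mul hf hg) (integrable_star_mul hf hh)]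
  simp [mul_sub]

theorem sphereInner_sub_left {f g h : CSpace d → ℂ} (hf : Continuous f) (hg : Continuous g)
    (hh : Continuous h) : sphereInner (f - g) h = sphereInner f h - sphereInner g h := by
  rw [← sphereInner_conj_symm, sphereInner_sub_right hh hf hg, map_sub, sphereInner_conj_symm,
    sphereInner_conj_symm]

theorem sphereInner_sum_right {ι : Type*} (t : Finset ι) {f : CSpace d → ℂ} {g : ι → CSpace d → ℂ}
    (hf : Continuous f) (hg : ∀ i, Continuous (g i)) :
    sphereInner f (∑ i ∈ t, g i) = ∑ i ∈ t, sphereInner f (g i) := by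
  simp only [sphereInner]
  rw [← integral_finsetSum _ fun i _ => integrable_star_mul hf (hg i)]
  simp [Finset.mul_sum]

theorem sphereInner_sum_left {ι : Type*} (t : Finset ι) {f : ι → CSpace d → ℂ} {g : CSpace d → ℂ}
    (hf : ∀ i, Continuous (f i)) (hg : Continuous g) :
    sphereInner (∑ i ∈ t, f i) g = ∑ i ∈ t, sphereInner (f i) g := by
  rw [← sphereInner_conj_symm, sphereInner_sum_right t hg hf, map_sum]
  simp only [sphereInner_conj_symm]

theorem eq_zero_of_sphereInner_self {f : CSpace d → ℂ} (hf : Continuous f)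
    (h : sphereInner f f = 0) : ∀ z ∈ Omega d, f z = 0 := by
  rw [sphereInner_self, Complex.ofReal_eq_zero] at h
  have hc : Continuous fun z : Omega d => ‖f z‖ ^ 2 := by fun_prop
  have hi : Integrable (fun z : Omega d => ‖f z‖ ^ 2) (omega d) :=
    hc.integrable_of_hasCompactSupport (HasCompactSupport.of_compactSpace _)
  rw [integral_eq_zero_iff_of_nonneg (fun z => by positivity) hi] at h
  intro z hz
  have := congrFun ((hc.ae_eq_iff_eq (omega d) continuous_zero).1 h) ⟨z, hz⟩
  simpa using this

/-- The inner product of `L²(Ω)` on the space of polynomial functions of given bidegree. -/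
@[reducible]
def homPolyCore (d k l : ℕ) [NeZero d] : InnerProductSpace.Core ℂ (HomPoly d k l) where
  inner f g := sphereInner (f : CSpace d → ℂ) g
  conj_inner_symm f g := sphereInner_conj_symm _ _
  re_inner_nonneg f := by
    rw [sphereInner_self]
    exact integral_nonneg fun z => by positivity
  add_left f g h := sphereInner_add_left (continuous_of_mem_homPoly f.2)
    (continuous_of_mem_homPoly g.2) (continuous_of_mem_homPoly h.2)
  smul_left f g c := sphereInner_smul_left c _ _
  definite f h := Subtype.ext <| eq_zero_of_eqOn_sphere f.2 <|
    eq_zero_of_sphereInner_self (continuous_of_mem_homPoly f.2) h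

theorem exists_orthonormal_basis_of_core {V : Type*} [AddCommGroup V] [Module ℂ V]
    [FiniteDimensional ℂ V] (c : InnerProductSpace.Core ℂ V) :
    ∃ b : Module.Basis (Fin (Module.finrank ℂ V)) ℂ V,
      ∀ i j, c.inner (b i) (b j) = if i = j then 1 else 0 := by
  let : NormedAddCommGroup V := c.toNormedAddCommGroup
  let : InnerProductSpace ℂ V := InnerProductSpace.ofCore c.toCore
  let b := stdOrthonormalBasis ℂ V
  refine ⟨b.toBasis, fun i j => ?_⟩
  rw [OrthonormalBasis.coe_toBasis]
  exact orthonormal_iff_ite.1 b.orthonormal i j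

theorem eq_of_sphereInner_eq {k l : ℕ} {f g : CSpace d → ℂ} (hf : f ∈ HomPoly d k l)
    (hg : g ∈ HomPoly d k l) (h : ∀ u ∈ HomPoly d k l, sphereInner f u = sphereInner g u) :
    f = g := by
  have hfg := Submodule.sub_mem _ hf hg
  have hc := continuous_of_mem_homPoly hfg
  rw [← sub_eq_zero]
  refine eq_zero_of_eqOn_sphere hfg (eq_zero_of_sphereInner_self hc ?_)
  rw [sphereInner_sub_left (continuous_of_mem_homPoly hf) (continuous_of_mem_homPoly hg) hc,
    h _ hfg, sub_self]

/-! ### Reproducing kernels. -/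

/-- `K` is the reproducing kernel of the space of polynomial functions of bidegree `(k, l)`. -/
structure IsReproducingKernel (k l : ℕ) (K : CSpace d → CSpace d → ℂ) : Prop where
  mem : ∀ x, K x ∈ HomPoly d k l
  reproducing : ∀ x, ∀ f ∈ HomPoly d k l, sphereInner (K x) f = f x
  trace : ∫ z : Omega d, K z z ∂(omega d) = Module.finrank ℂ (HomPoly d k l)

/-- For an orthonormal basis b_i, take K_x = ∑ conj(b_i(x)) b_i; its diagonal is ∑ |b_i|², with
integral the dimension. -/
theorem exists_isReproducingKernel (d k l : ℕ) [NeZero d] :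
    ∃ K : CSpace d → CSpace d → ℂ, IsReproducingKernel k l K := by
  obtain ⟨b, hb⟩ := exists_orthonormal_basis_of_core (homPolyCore d k l)
  change ∀ i j, sphereInner (b i : CSpace d → ℂ) (b j) = _ at hb
  have hbc (i) : Continuous (b i : CSpace d → ℂ) := continuous_of_mem_homPoly (b i).2
  refine ⟨fun x => ∑ i, (starRingEnd ℂ) ((b i : CSpace d → ℂ) x) • (b i : CSpace d → ℂ), ?_, ?_, ?_⟩
  · exact fun x => Submodule.sum_mem _ fun i _ => Submodule.smul_mem _ _ (b i).2
  · intro x f hf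
    have hfb : f = ∑ j, b.repr ⟨f, hf⟩ j • (b j : CSpace d → ℂ) := by
      conv_lhs => rw [← Subtype.coe_mk f hf, ← b.sum_repr ⟨f, hf⟩]
      rw [Submodule.coe_sum]
      rfl
    rw [sphereInner_sum_left _ (fun i => (hbc i).const_smul _) (continuous_of_mem_homPoly hf)]
    have hi (i) : sphereInner (b i : CSpace d → ℂ) f = b.repr ⟨f, hf⟩ i := by
      conv_lhs => rw [hfb]
      rw [sphereInner_sum_right _ (hbc i) (fun j => (hbc j).const_smul _)]
      simp [sphereInner_smul_right, hb]
    conv_rhs => rw [hfb]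
    simp [sphereInner_smul_left, hi, mul_comm]
  · simp only [Finset.sum_apply, Pi.smul_apply, smul_eq_mul]
    rw [integral_finsetSum _ fun i _ => integrable_star_mul (hbc i) (hbc i)]
    have this (i) := hb i i
    simp only [sphereInner, if_true] at this
    simp [this]

namespace IsReproducingKernel
variable {k l : ℕ} {K : CSpace d → CSpace d → ℂ}

/-- By invariance of the measure, K_{gx} ∘ g also reproduces values at x, and such an element is
unique. -/
theorem apply_unitary (hK : IsReproducingKernel k l K) (g : CSpace d ≃ₗᵢ[ℂ] CSpace d)
    (x y : CSpace d) : K (g x) (g y) = K x y := by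
  refine congrFun (a := y) (f := K (g x) ∘ g) (eq_of_sphereInner_eq
    (comp_mem_homPoly (hK.mem (g x)) g.toLinearEquiv.toLinearMap) (hK.mem x) fun f hf => ?_)
  rw [hK.reproducing x f hf, sphereInner]
  have hf' : f ∘ g.symm ∈ HomPoly d k l := comp_mem_homPoly hf g.symm.toLinearEquiv.toLinearMap
  have h := hK.reproducing (g x) _ hf'
  rw [sphereInner, ← integral_omega_comp g
    (fun z => (starRingEnd ℂ) (K (g x) z) * (f ∘ g.symm) z)] at h
  simpa using h

/-- The unitary group is transitive on the sphere, so the diagonal is constant and equals its mean.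
-/
theorem apply_self (hK : IsReproducingKernel k l K) (hd : 2 ≤ d) {x : CSpace d}
    (hx : x ∈ Omega d) : K x x = Module.finrank ℂ (HomPoly d k l) := by
  have hperp (x : CSpace d) : ∃ x', ‖x'‖ = 1 ∧ inner ℂ x x' = 0 := by
    have hlt : (ℂ ∙ x) ≠ ⊤ := by
      intro h
      have h1 := finrank_span_le_card (R := ℂ) ({x} : Set (CSpace d))
      rw [h, finrank_top, finrank_euclideanSpace, Fintype.card_fin, Set.toFinset_singleton,
        Finset.card_singleton] at h1
      omega
    have hne : (ℂ ∙ x)ᗮ ≠ ⊥ := fun h => hlt ((Submodule.orthogonal_eq_bot_iff).1 h)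
    obtain ⟨w, hw, hw0⟩ := Submodule.exists_mem_ne_zero_of_ne_bot hne
    refine ⟨((‖w‖ : ℝ) : ℂ)⁻¹ • w, ?_, ?_⟩
    · simp [norm_smul, hw0]
    · rw [inner_smul_right, Submodule.mem_orthogonal_singleton_iff_inner_right.1 hw, mul_zero]
  rw [← hK.trace]
  have hconst (z : Omega d) : K z z = K x x := by
    obtain ⟨x', hx', hxx'⟩ := hperp x
    obtain ⟨z', hz', hzz'⟩ := hperp z
    obtain ⟨g, hg, -⟩ := exists_linearIsometryEquiv_pair (by simpa using hx) hx' hxx'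
      (by simp) hz' hzz'
    rw [← hg, hK.apply_unitary]
  simp [hconst]

end IsReproducingKernel

end

/-! ### Restriction to real planes and the zonal polynomial. -/

/-- Binary forms of degree `n` in two real variables, as functions. -/
def binaryForms (n : ℕ) : Submodule ℂ (ℝ × ℝ → ℂ) :=
  Submodule.span ℂ {f | ∃ i j, i + j = n ∧ f = fun v => (v.1 : ℂ) ^ i * (v.2 : ℂ) ^ j}

theorem linear_mul_mem_binaryForms {n : ℕ} {f : ℝ × ℝ → ℂ} (hf : f ∈ binaryForms n) (a b : ℂ) :
    (fun v : ℝ × ℝ => (v.1 : ℂ) * a + v.2 * b) * f ∈ binaryForms (n + 1) := by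
  induction hf using Submodule.span_induction with
  | mem f hf =>
    obtain ⟨i, j, rfl, rfl⟩ := hf
    have h1 : (fun v : ℝ × ℝ => (v.1 : ℂ) ^ (i + 1) * (v.2 : ℂ) ^ j) ∈ binaryForms (i + j + 1) :=
      Submodule.subset_span ⟨_, _, by omega, rfl⟩
    have h2 : (fun v : ℝ × ℝ => (v.1 : ℂ) ^ i * (v.2 : ℂ) ^ (j + 1)) ∈ binaryForms (i + j + 1) :=
      Submodule.subset_span ⟨_, _, by omega, rfl⟩
    convert Submodule.add_mem _ (Submodule.smul_mem _ a h1) (Submodule.smul_mem _ b h2) using 1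
    ext v
    simp only [Pi.mul_apply, Pi.add_apply, Pi.smul_apply, smul_eq_mul]
    ring
  | zero => rw [mul_zero]; exact Submodule.zero_mem _
  | add f g _ _ hf hg => rw [mul_add]; exact Submodule.add_mem _ hf hg
  | smul c f _ hf => rw [mul_smul_comm]; exact Submodule.smul_mem _ c hf

/-- On a real plane, coordinates and their conjugates alike become linear forms in two real
variables, so only the total degree survives. -/
theorem comp_plane_mem_binaryForms {k l : ℕ} {f : CSpace d → ℂ} (hf : f ∈ HomPoly d k l)
    (e e' : CSpace d) :
    (fun v : ℝ × ℝ => f ((v.1 : ℂ) • e + (v.2 : ℂ) • e')) ∈ binaryForms (k + l) := by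
  refine homPoly_le_of_closed (p := fun k l => (binaryForms (k + l)).comap
    (LinearMap.funLeft ℂ ℂ fun v : ℝ × ℝ => (v.1 : ℂ) • e + (v.2 : ℂ) • e')) ?_ ?_ ?_ k l hf
  · exact Submodule.subset_span ⟨0, 0, rfl, by ext v; simp⟩
  · intro i k l f hf
    have := linear_mul_mem_binaryForms (Submodule.mem_comap.1 hf) (e i) (e' i)
    rw [Submodule.mem_comap, add_right_comm]
    convert this using 1
    ext v
    simp
  · intro i k l f hf
    have := linear_mul_mem_binaryForms (Submodule.mem_comap.1 hf) (star (e i)) (star (e' i))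
    rw [Submodule.mem_comap, ← add_assoc]
    convert this using 1
    ext v
    simp

/-- Symmetrizing in b removes odd powers of b. As the degree is odd, the remaining powers of r are
odd, and b² = 1 - r². -/
theorem exists_polynomial_of_binaryForms {m : ℕ} {f : ℝ × ℝ → ℂ}
    (hf : f ∈ binaryForms (2 * m + 1)) :
    ∃ p : Polynomial ℂ, p.natDegree ≤ m ∧ ∀ r b : ℝ, r ^ 2 + b ^ 2 = 1 →
      f (r, b) + f (r, -b) = r * p.eval ((r : ℂ) ^ 2) := by
  induction hf using Submodule.span_induction with
  | mem f hf =>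
    obtain ⟨i, j, hij, rfl⟩ := hf
    rcases Nat.even_or_odd' j with ⟨q, rfl | rfl⟩
    · obtain ⟨a, rfl⟩ : ∃ a, i = 2 * a + 1 := ⟨m - q, by omega⟩
      refine ⟨Polynomial.C 2 * (Polynomial.X ^ a * (1 - Polynomial.X) ^ q), ?_, ?_⟩
      · have h1 : (1 - Polynomial.X : Polynomial ℂ).natDegree ≤ 1 := by
          refine (Polynomial.natDegree_sub_le _ _).trans ?_
          simp
        have h2 := Polynomial.natDegree_pow_le_of_le q h1
        have h3 := Polynomial.natDegree_mul_le_of_le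
          (Polynomial.natDegree_X_pow_le (R := ℂ) a) h2
        exact (Polynomial.natDegree_C_mul_le _ _).trans (h3.trans (by omega))
      · intro r b hrb
        have hb : (b : ℂ) ^ 2 = 1 - (r : ℂ) ^ 2 := by
          rw [eq_sub_iff_add_eq']; exact_mod_cast hrb
        simp only [Complex.ofReal_neg, pow_mul, neg_sq, hb, Polynomial.eval_mul,
          Polynomial.eval_C, Polynomial.eval_pow, Polynomial.eval_X, Polynomial.eval_sub,
          Polynomial.eval_one]
        ring
    · refine ⟨0, by simp, fun r b _ => ?_⟩
      simp only [Complex.ofReal_neg, Odd.neg_pow ⟨q, rfl⟩]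
      simp
  | zero => exact ⟨0, by simp, by simp⟩
  | add f g _ _ hf hg =>
    obtain ⟨p, hp, hp'⟩ := hf
    obtain ⟨q, hq, hq'⟩ := hg
    refine ⟨p + q, Polynomial.natDegree_add_le_of_degree_le hp hq, fun r b h => ?_⟩
    rw [Polynomial.eval_add, mul_add, ← hp' r b h, ← hq' r b h, Pi.add_apply, Pi.add_apply]
    ring
  | smul c f _ hf =>
    obtain ⟨p, hp, hp'⟩ := hf
    refine ⟨c • p, (Polynomial.natDegree_smul_le _ _).trans hp, fun r b h => ?_⟩
    rw [Polynomial.eval_smul, smul_eq_mul, mul_left_comm, ← hp' r b h, Pi.smul_apply,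
      Pi.smul_apply, smul_eq_mul, smul_eq_mul, mul_add]

theorem exists_plane_coordinates {x y : CSpace d} (hx : ‖x‖ = 1) (hy : ‖y‖ = 1)
    (h0 : inner ℂ x y ≠ 0) (h1 : ‖inner ℂ x y‖ < 1) :
    ∃ (u : ℂ) (b : ℝ) (x' : CSpace d), u ≠ 0 ∧ ‖inner ℂ x y‖ ^ 2 + b ^ 2 = 1 ∧ ‖x'‖ = 1 ∧
      inner ℂ x x' = 0 ∧ y = u • (((‖inner ℂ x y‖ : ℝ) : ℂ) • x + (b : ℂ) • x') := by
  set a : ℂ := inner ℂ x y with ha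
  have hr : ((‖a‖ : ℝ) : ℂ) ≠ 0 := by simpa using h0
  set u : ℂ := a / (‖a‖ : ℝ) with hu
  have hu1 : ‖u‖ = 1 := by
    rw [hu, norm_div, Complex.norm_real, norm_norm, div_self (by simpa using h0)]
  have hu0 : u ≠ 0 := by rw [← norm_ne_zero_iff, hu1]; exact one_ne_zero
  have hxx : inner ℂ x x = (1 : ℂ) := by rw [inner_self_eq_norm_sq_to_K, hx]; simp
  have hperp : inner ℂ x (y - a • x) = 0 := by
    rw [inner_sub_right, inner_smul_right, hxx, mul_one, ← ha, sub_self]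
  have hnorm : ‖y - a • x‖ ^ 2 = 1 - ‖a‖ ^ 2 := by
    have h := norm_add_sq_eq_norm_sq_add_norm_sq_of_inner_eq_zero (a • x) (y - a • x) (𝕜 := ℂ)
      (by rw [inner_smul_left, hperp, mul_zero])
    rw [add_sub_cancel, hy, norm_smul, hx] at h
    linarith
  have hb : 0 < ‖y - a • x‖ := by
    rw [norm_pos_iff]
    intro h
    rw [h, norm_zero] at hnorm
    nlinarith [norm_nonneg a]
  have hb' : ((‖y - a • x‖ : ℝ) : ℂ) ≠ 0 := by exact_mod_cast hb.ne'
  refine ⟨u, ‖y - a • x‖, (u * (‖y - a • x‖ : ℝ))⁻¹ • (y - a • x), hu0, by linarith, ?_, ?_, ?_⟩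
  · rw [norm_smul, norm_inv, norm_mul, hu1, Complex.norm_real, norm_norm, one_mul,
      inv_mul_cancel₀ hb.ne']
  · rw [inner_smul_right, hperp, mul_zero]
  · have h2 : u * (‖y - a • x‖ : ℝ) * (u * (‖y - a • x‖ : ℝ))⁻¹ = 1 :=
      mul_inv_cancel₀ (mul_ne_zero hu0 hb')
    have h3 : u * (‖a‖ : ℝ) = a := by rw [hu]; field_simp
    rw [smul_add, smul_smul, smul_smul, smul_smul, h3, h2, one_smul, add_sub_cancel]

/-- One polynomial handles all pairs: p comes from K_e symmetrized on the plane of e and e'. A zero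
K(x, y) is moved there by a unitary map, after stripping from y the phase of x^*y. -/
theorem IsReproducingKernel.exists_zonal_polynomial [NeZero d] {m : ℕ}
    {K : CSpace d → CSpace d → ℂ} (hK : IsReproducingKernel (m + 1) m K) {e e' : CSpace d}
    (he : ‖e‖ = 1) (he' : ‖e'‖ = 1) (hee' : inner ℂ e e' = 0) :
    ∃ p : Polynomial ℂ, p.natDegree ≤ m ∧ p.eval 1 = 2 * K e e ∧
      ∀ x y : CSpace d, ‖x‖ = 1 → ‖y‖ = 1 → inner ℂ x y ≠ 0 → ‖inner ℂ x y‖ < 1 → K x y = 0 →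
        p.eval (((‖inner ℂ x y‖ ^ 2 : ℝ) : ℂ)) = 0 := by
  have hf := comp_plane_mem_binaryForms (hK.mem e) e e'
  rw [show m + 1 + m = 2 * m + 1 by ring] at hf
  obtain ⟨p, hp, hpe⟩ := exists_polynomial_of_binaryForms hf
  refine ⟨p, hp, ?_, fun x y hx hy h0 h1 hK0 => ?_⟩
  · have := hpe 1 0 (by norm_num)
    simp only [Complex.ofReal_one, Complex.ofReal_zero, one_smul, zero_smul, add_zero, one_pow,
      neg_zero, one_mul] at this
    rw [← this, two_mul]
  · obtain ⟨u, b, x', hu, hrb, hx', hxx', hy'⟩ := exists_plane_coordinates hx hy h0 h1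
    set r := ‖inner ℂ x y‖ with hr
    have hr0 : (r : ℂ) ≠ 0 := by simpa [hr] using h0
    rw [hy', homPoly_smul_apply (hK.mem x)] at hK0
    have hK1 : K x ((r : ℂ) • x + (b : ℂ) • x') = 0 := by
      simpa [hu] using hK0
    -- Needed for v = e' and v = -e', so that both terms of the symmetrization vanish.
    have hv (v : CSpace d) (hv : ‖v‖ = 1) (hev : inner ℂ e v = 0) :
        K e ((r : ℂ) • e + (b : ℂ) • v) = 0 := by
      obtain ⟨g, hg, hg'⟩ := exists_linearIsometryEquiv_pair hx hx' hxx' he hv hev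
      rw [← hg, ← hg', ← map_smul, ← map_smul, ← map_add, hK.apply_unitary, hK1]
    have h3 := hpe r b hrb
    have h4 : (((-b : ℝ) : ℂ)) • e' = (b : ℂ) • (-e') := by simp
    simp only [h4] at h3
    rw [hv e' he' hee', hv (-e') (by simpa using he') (by simpa using hee'), add_zero] at h3
    rw [Complex.ofReal_pow]
    exact (mul_eq_zero.1 h3.symm).resolve_left hr0

/-! ### Annihilators and the degree set. -/

/-- The product `x^*y ∏_{α ∈ t} (|x^*y|² - α y^*y)`, as a function of `y`. -/
def annihilator (t : Finset ℝ) (x : CSpace d) : CSpace d → ℂ :=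
  (fun y => inner ℂ x y) *
    ∏ α ∈ t, ((fun y => ((‖inner ℂ x y‖ ^ 2 : ℝ) : ℂ)) - (α : ℂ) • fun y => ((‖y‖ ^ 2 : ℝ) : ℂ))

theorem annihilator_apply (t : Finset ℝ) (x y : CSpace d) :
    annihilator t x y =
      inner ℂ x y * ((∏ α ∈ t, (‖inner ℂ x y‖ ^ 2 - α * ‖y‖ ^ 2) : ℝ) : ℂ) := by
  simp [annihilator, Finset.prod_apply]

theorem annihilator_mem (t : Finset ℝ) (x : CSpace d) :
    annihilator t x ∈ HomPoly d (t.card + 1) t.card := by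
  have := mul_mem_homPoly (inner_mem_homPoly x) (prod_mem_homPoly t fun α _ =>
    Submodule.sub_mem _ (norm_inner_sq_mem_homPoly x)
      (Submodule.smul_mem _ (α : ℂ) norm_sq_mem_homPoly))
  rwa [mul_one, add_comm 1, zero_add] at this

theorem annihilator_conj (t : Finset ℝ) {x y : CSpace d} (hx : ‖x‖ = 1) (hy : ‖y‖ = 1) :
    (starRingEnd ℂ) (annihilator t x y) = annihilator t y x := by
  rw [annihilator_apply, annihilator_apply, map_mul, inner_conj_symm, Complex.conj_ofReal,
    norm_inner_symm x y, hx, hy]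

theorem annihilator_self (t : Finset ℝ) {x : CSpace d} (hx : ‖x‖ = 1) :
    annihilator t x x = ((∏ α ∈ t, (1 - α) : ℝ) : ℂ) := by
  rw [annihilator_apply, inner_self_eq_norm_sq_to_K, hx]
  simp

theorem annihilator_eq_zero {X : Set (CSpace d)} (hX : X ⊆ Omega d) {t : Finset ℝ}
    (ht : degreeSet X ⊆ insert 0 (t : Set ℝ)) {x y : CSpace d} (hx : x ∈ X) (hy : y ∈ X)
    (hxy : x ≠ y) : annihilator t x y = 0 := by
  rw [annihilator_apply]
  rcases ht ⟨x, hx, y, hy, hxy, rfl⟩ with h | h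
  · rw [norm_eq_zero.1 (pow_eq_zero_iff two_ne_zero |>.1 h), zero_mul]
  · rw [Finset.prod_eq_zero h, Complex.ofReal_zero, mul_zero]
    have hy1 : ‖y‖ = 1 := by simpa using hX hy
    rw [hy1]; ring

theorem norm_inner_lt_one {X : Set (CSpace d)} (hX : IsLineSet X) {x y : CSpace d} (hx : x ∈ X)
    (hy : y ∈ X) (hxy : x ≠ y) : ‖inner ℂ x y‖ < 1 := by
  have hx1 : ‖x‖ = 1 := by simpa using hX.1 hx
  have hy1 : ‖y‖ = 1 := by simpa using hX.1 hy
  have hx0 : x ≠ 0 := by rintro rfl; simp at hx1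
  have hy0 : y ≠ 0 := by rintro rfl; simp at hy1
  refine lt_of_le_of_ne (by simpa [hx1, hy1] using norm_inner_le_norm (𝕜 := ℂ) x y) fun h => ?_
  have h' : ‖inner ℂ x y‖ = ‖x‖ * ‖y‖ := by rw [h, hx1, hy1, one_mul]
  obtain ⟨r, hr, hyr⟩ := (norm_inner_eq_norm_iff hx0 hy0).1 h'
  refine hxy (hX.2 hx hy ?_)
  simp only
  rw [hyr, Submodule.span_singleton_smul_eq (IsUnit.mk0 r hr)]

theorem lt_one_of_mem_degreeSet {X : Set (CSpace d)} (hX : IsLineSet X) {α : ℝ}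
    (hα : α ∈ degreeSet X) : α < 1 := by
  obtain ⟨x, hx, y, hy, hxy, rfl⟩ := hα
  have := norm_inner_lt_one hX hx hy hxy
  nlinarith [norm_nonneg (inner ℂ x y : ℂ)]

/-- The degree 0 is left out of t, since the factor x^*y of the annihilator accounts for it. -/
theorem exists_finset_of_encard_degreeSet {X : Set (CSpace d)} (hX : IsLineSet X)
    (h0 : (0 : ℝ) ∈ degreeSet X) {s : ℕ} (hs : (degreeSet X).encard = s) :
    ∃ t : Finset ℝ, t.card + 1 = s ∧ degreeSet X ⊆ insert 0 (t : Set ℝ) ∧ ∀ α ∈ t, α < 1 := by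
  have hfin : (degreeSet X).Finite := Set.finite_of_encard_eq_coe hs
  refine ⟨hfin.toFinset.erase 0, ?_, ?_, ?_⟩
  · rw [Finset.card_erase_add_one (by simpa using h0)]
    rw [hfin.encard_eq_coe_toFinset_card] at hs
    exact_mod_cast hs
  · intro α hα
    by_cases h : α = 0
    · exact Or.inl h
    · exact Or.inr (by simp [h, hα])
  · intro α hα
    exact lt_one_of_mem_degreeSet hX (by simpa using (Finset.mem_erase.1 hα).2)

/-! ### Evaluation maps and designs. -/

/-- Evaluation of polynomial functions at the points of a finite set. -/
def evalOn (k l : ℕ) (Y : Finset (CSpace d)) : HomPoly d k l →ₗ[ℂ] (Y → ℂ) where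
  toFun f x := (f : CSpace d → ℂ) x
  map_add' _ _ := rfl
  map_smul' _ _ := rfl

/-- On Y the annihilators are nonzero multiples of the delta functions. -/
theorem evalOn_surjective_of_annihilator {t : Finset ℝ} {Y : Finset (CSpace d)}
    (hY : IsLineSet (Y : Set (CSpace d)))
    (ht : degreeSet (Y : Set (CSpace d)) ⊆ insert 0 (t : Set ℝ))
    (ht1 : ∀ α ∈ t, α < 1) : Function.Surjective (evalOn (t.card + 1) t.card Y) := by
  have hc : ((∏ α ∈ t, (1 - α) : ℝ) : ℂ) ≠ 0 := by
    rw [Complex.ofReal_ne_zero, Finset.prod_ne_zero_iff]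
    exact fun α hα => (sub_pos.2 (ht1 α hα)).ne'
  intro v
  refine ⟨∑ x : Y, (v x / ((∏ α ∈ t, (1 - α) : ℝ) : ℂ)) •
    ⟨annihilator t (x : CSpace d), annihilator_mem t _⟩, ?_⟩
  ext y
  have hy : ‖(y : CSpace d)‖ = 1 := by simpa using hY.1 y.2
  rw [map_sum, Finset.sum_apply, Finset.sum_eq_single y]
  · change _ * annihilator t (y : CSpace d) y = _
    rw [annihilator_self t hy, div_mul_cancel₀ _ hc]
  · intro x _ hxy
    change _ * annihilator t (x : CSpace d) y = _
    rw [annihilator_eq_zero hY.1 ht x.2 y.2 (fun h => hxy (Subtype.ext h)), mul_zero]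
  · simp

theorem isDesign_coe_iff {n : ℕ} {Y : Finset (CSpace d)} (hY : Y.Nonempty) :
    IsDesign n (Y : Set (CSpace d)) ↔ ∀ f ∈ HomPoly d n n,
      ∑ x ∈ Y, f x = Y.card * ∫ z : Omega d, f z ∂(omega d) := by
  have hc : (Y.card : ℂ) ≠ 0 := by exact_mod_cast hY.card_pos.ne'
  have h (a b : ℂ) : 1 / (Y.card : ℂ) * a = b ↔ a = Y.card * b := by
    constructor
    · rintro rfl; field_simp
    · rintro rfl; field_simp
  constructor
  · rintro ⟨hfin, H⟩ f hf
    have := H f hf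
    rwa [Finset.finite_toSet_toFinset, h] at this
  · intro H
    refine ⟨Y.finite_toSet, fun f hf => ?_⟩
    rw [Finset.finite_toSet_toFinset, h]
    exact H f hf

/-- Rests on Hom(2m+1, 2m+1) = Hom(m, m+1) · Hom(m+1, m), the first factor being the conjugate of
the second. -/
theorem isDesign_iff_sphereInner [NeZero d] {m : ℕ} {Y : Finset (CSpace d)} (hY : Y.Nonempty) :
    IsDesign (2 * m + 1) (Y : Set (CSpace d)) ↔
      ∀ f ∈ HomPoly d (m + 1) m, ∀ g ∈ HomPoly d (m + 1) m,
        ∑ x ∈ Y, (starRingEnd ℂ) (f x) * g x = Y.card * sphereInner f g := by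
  rw [isDesign_coe_iff hY]
  have e1 : 2 * m + 1 = m + (m + 1) := by ring
  have e2 : 2 * m + 1 = (m + 1) + m := by ring
  constructor
  · intro H f hf g hg
    refine H (star f * g) ?_
    convert mul_mem_homPoly (star_mem_homPoly hf) hg using 1
    exact congrArg₂ (HomPoly d) e1 e2
  · intro H f hf
    rw [congrArg₂ (HomPoly d) e1 e2, ← homPoly_mul] at hf
    have key : Continuous f ∧ ∑ x ∈ Y, f x = Y.card * ∫ z : Omega d, f z ∂(omega d) := by
      induction hf using Submodule.mul_induction_on' with
      | mem_mul_mem f hf g hg =>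
        refine ⟨(continuous_of_mem_homPoly hf).mul (continuous_of_mem_homPoly hg), ?_⟩
        simpa [sphereInner] using H (star f) (star_mem_homPoly hf) g hg
      | add f _ g _ hf hg =>
        refine ⟨hf.1.add hg.1, ?_⟩
        simp only [Pi.add_apply]
        rw [Finset.sum_add_distrib, hf.2, hg.2,
          integral_add (integrable_omega hf.1) (integrable_omega hg.1), mul_add]
    exact key.2

theorem evalOn_injective_of_isDesign [NeZero d] {m : ℕ} {Y : Finset (CSpace d)} (hY : Y.Nonempty)
    (H : IsDesign (2 * m + 1) (Y : Set (CSpace d))) :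
    Function.Injective (evalOn (m + 1) m Y) := by
  rw [injective_iff_map_eq_zero]
  intro f hf
  have hf0 (x) (hx : x ∈ Y) : (f : CSpace d → ℂ) x = 0 := congrFun hf ⟨x, hx⟩
  have h := (isDesign_iff_sphereInner hY).1 H f f.2 f f.2
  rw [Finset.sum_eq_zero fun x hx => by rw [hf0 x hx, mul_zero], eq_comm, mul_eq_zero] at h
  have hc : (Y.card : ℂ) ≠ 0 := by exact_mod_cast hY.card_pos.ne'
  exact Subtype.ext (eq_zero_of_eqOn_sphere f.2
    (eq_zero_of_sphereInner_self (continuous_of_mem_homPoly f.2) (h.resolve_left hc)))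

theorem isDesign_of_annihilator [NeZero d] (hd : 2 ≤ d) {t : Finset ℝ} {Y : Finset (CSpace d)}
    (hne : Y.Nonempty) (hY : IsLineSet (Y : Set (CSpace d)))
    (ht : degreeSet (Y : Set (CSpace d)) ⊆ insert 0 (t : Set ℝ)) (ht1 : ∀ α ∈ t, α < 1)
    (hcard : Y.card = Module.finrank ℂ (HomPoly d (t.card + 1) t.card)) :
    IsDesign (2 * t.card + 1) (Y : Set (CSpace d)) := by
  obtain ⟨K, hK⟩ := exists_isReproducingKernel d (t.card + 1) t.card
  set c : ℝ := ∏ α ∈ t, (1 - α) with hc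
  obtain ⟨n, hn⟩ : ∃ n : ℝ, n = Y.card := ⟨_, rfl⟩
  have hc0 : (c : ℂ) ≠ 0 := by
    rw [Complex.ofReal_ne_zero, hc, Finset.prod_ne_zero_iff]
    exact fun α hα => (sub_pos.2 (ht1 α hα)).ne'
  have hn0 : (n : ℂ) ≠ 0 := by
    rw [Complex.ofReal_ne_zero, hn]; exact_mod_cast hne.card_pos.ne'
  have hunit (x) (hx : x ∈ Y) : ‖x‖ = 1 := by simpa using hY.1 hx
  have hF (x : CSpace d) : annihilator t x ∈ HomPoly d (t.card + 1) t.card := annihilator_mem t x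
  have hFc (x : CSpace d) : Continuous (annihilator t x) := continuous_of_mem_homPoly (hF x)
  have hself (x : CSpace d) (hx : ‖x‖ = 1) : annihilator t x x = c := annihilator_self t hx
  have hinj : Function.Injective (evalOn (t.card + 1) t.card Y) :=
    (LinearMap.injective_iff_surjective_of_finrank_eq_finrank (by simp [hcard])).2
      (evalOn_surjective_of_annihilator hY ht ht1)
  have hexp (f) (hf : f ∈ HomPoly d (t.card + 1) t.card) :
      f = ∑ x ∈ Y, (f x / c) • annihilator t x := by
    have hg : ∑ x ∈ Y, (f x / c) • annihilator t x ∈ HomPoly d (t.card + 1) t.card :=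
      Submodule.sum_mem _ fun x _ => Submodule.smul_mem _ _ (hF x)
    refine congrArg Subtype.val (hinj (a₁ := ⟨f, hf⟩) (a₂ := ⟨_, hg⟩) (funext fun y => ?_))
    change f y = (∑ x ∈ Y, (f x / c) • annihilator t x) y
    rw [Finset.sum_apply, Finset.sum_eq_single (y : CSpace d)]
    · rw [Pi.smul_apply, hself _ (hunit _ y.2), smul_eq_mul, div_mul_cancel₀ _ hc0]
    · intro x hx hxy
      rw [Pi.smul_apply, annihilator_eq_zero hY.1 ht hx y.2 hxy, smul_zero]
    · exact fun h => absurd y.2 h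
  -- Expand F_z along the F_x and evaluate at z, where F_z(z) = c and F_z(x) = conj(F_x(z)).
  have hpoint (z : Omega d) :
      ∑ x ∈ Y, (starRingEnd ℂ) (annihilator t x z) * annihilator t x z = (c : ℂ) ^ 2 := by
    have hz : ‖(z : CSpace d)‖ = 1 := by simp
    have h := congrFun (hexp _ (hF z)) z
    rw [hself _ hz, Finset.sum_apply] at h
    rw [sq]
    nth_rewrite 1 [h]
    rw [Finset.sum_mul]
    refine Finset.sum_congr rfl fun x hx => ?_
    rw [annihilator_conj t (hunit x hx) hz, Pi.smul_apply, smul_eq_mul]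
    field_simp
  have hsum : ∑ x ∈ Y, sphereInner (annihilator t x) (annihilator t x) = (c : ℂ) ^ 2 := by
    simp only [sphereInner]
    rw [← integral_finsetSum _ fun x _ => integrable_star_mul (hFc x) (hFc x)]
    simp [hpoint]
  set u : CSpace d → CSpace d → ℂ := fun x => K x - ((n / c : ℝ) : ℂ) • annihilator t x with hu
  have hKc (x) : Continuous (K x) := continuous_of_mem_homPoly (hK.mem x)
  have huc (x) : Continuous (u x) := (hKc x).sub ((hFc x).const_smul _)
  have huu (x) (hx : x ∈ Y) : sphereInner (u x) (u x) =
      -n + (n / c) ^ 2 * sphereInner (annihilator t x) (annihilator t x) := by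
    have h1 : sphereInner (K x) (annihilator t x) = c := by
      rw [hK.reproducing x _ (hF x), hself x (hunit x hx)]
    have h2 : sphereInner (annihilator t x) (K x) = c := by
      rw [← sphereInner_conj_symm, h1, Complex.conj_ofReal]
    have h3 : sphereInner (K x) (K x) = n := by
      rw [hK.reproducing x _ (hK.mem x), hK.apply_self hd (hY.1 hx), ← hcard, hn]
      simp
    rw [hu]
    simp only
    rw [sphereInner_sub_left (hKc x) ((hFc x).const_smul _) (huc x),
      sphereInner_sub_right (hKc x) (hKc x) ((hFc x).const_smul _),
      sphereInner_sub_right ((hFc x).const_smul _) (hKc x) ((hFc x).const_smul _),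
      sphereInner_smul_left, sphereInner_smul_right, sphereInner_smul_left,
      sphereInner_smul_right, h1, h2, h3, Complex.conj_ofReal]
    push_cast
    field_simp
    ring
  -- The total is -n² + (n/c)² c².
  have hzero : ∑ x ∈ Y, sphereInner (u x) (u x) = 0 := by
    rw [Finset.sum_congr rfl huu, Finset.sum_add_distrib, ← Finset.mul_sum, hsum,
      Finset.sum_const, nsmul_eq_mul]
    have : (Y.card : ℂ) = n := by rw [hn]; simp
    rw [this]
    field_simp
    ring
  have hKF (x) (hx : x ∈ Y) : K x = ((n / c : ℝ) : ℂ) • annihilator t x := by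
    have hmem : u x ∈ HomPoly d (t.card + 1) t.card :=
      Submodule.sub_mem _ (hK.mem x) (Submodule.smul_mem _ _ (hF x))
    refine sub_eq_zero.1 (eq_zero_of_eqOn_sphere hmem (eq_zero_of_sphereInner_self (huc x) ?_))
    simp only [sphereInner_self] at hzero ⊢
    rw [← Complex.ofReal_sum, Complex.ofReal_eq_zero, Finset.sum_eq_zero_iff_of_nonneg
      fun x _ => integral_nonneg fun z => by positivity] at hzero
    rw [hzero x hx, Complex.ofReal_zero]
  rw [isDesign_iff_sphereInner hne]
  intro f hf g hg
  conv_rhs => rw [hexp g hg]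
  rw [sphereInner_sum_right _ (continuous_of_mem_homPoly hf) fun x => (hFc x).const_smul _,
    Finset.mul_sum]
  refine Finset.sum_congr rfl fun x hx => ?_
  have h1 : annihilator t x = ((c / n : ℝ) : ℂ) • K x := by
    rw [hKF x hx, smul_smul, ← Complex.ofReal_mul]
    have : c / n * (n / c) = 1 := by
      rw [Complex.ofReal_ne_zero] at hc0 hn0
      field_simp
    rw [this, Complex.ofReal_one, one_smul]
  rw [h1, sphereInner_smul_right, sphereInner_smul_right, ← sphereInner_conj_symm,
    hK.reproducing x f hf]
  have : (Y.card : ℂ) = n := by rw [hn]; simp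
  rw [this]
  push_cast
  field_simp

theorem encard_degreeSet_le_of_isDesign [NeZero d] {m : ℕ} {Y : Finset (CSpace d)}
    (hY : IsLineSet (Y : Set (CSpace d))) (h0 : (0 : ℝ) ∈ degreeSet (Y : Set (CSpace d)))
    (H : IsDesign (2 * m + 1) (Y : Set (CSpace d))) (hd : 2 ≤ d)
    (hcard : Y.card = Module.finrank ℂ (HomPoly d (m + 1) m)) :
    (degreeSet (Y : Set (CSpace d))).encard ≤ (m + 1 : ℕ) := by
  obtain ⟨e, he, e', he', -, hee'⟩ := h0
  have hne : Y.Nonempty := ⟨e, he⟩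
  have hunit (x) (hx : x ∈ Y) : ‖x‖ = 1 := by simpa using hY.1 hx
  obtain ⟨K, hK⟩ := exists_isReproducingKernel d (m + 1) m
  have hsurj : Function.Surjective (evalOn (m + 1) m Y) :=
    (LinearMap.injective_iff_surjective_of_finrank_eq_finrank (by simp [hcard])).1
      (evalOn_injective_of_isDesign hne H)
  have hK0 (x) (hx : x ∈ Y) (y) (hy : y ∈ Y) (hxy : x ≠ y) : K x y = 0 := by
    classical
    obtain ⟨δ, hδ⟩ := hsurj fun y => if (y : CSpace d) = x then 1 else 0
    have hδ' (y) (hy : y ∈ Y) : (δ : CSpace d → ℂ) y = if y = x then 1 else 0 :=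
      congrFun hδ ⟨y, hy⟩
    -- By the design identity, |Y| δ has the same inner products with V as K_x.
    have hKδ : K x = (Y.card : ℂ) • (δ : CSpace d → ℂ) := by
      refine eq_of_sphereInner_eq (hK.mem x) (Submodule.smul_mem _ _ δ.2) fun f hf => ?_
      rw [hK.reproducing x f hf, sphereInner_smul_left, Complex.conj_natCast,
        ← (isDesign_iff_sphereInner hne).1 H _ δ.2 f hf, Finset.sum_eq_single x]
      · simp [hδ' x hx]
      · intro y hy hyx
        simp [hδ' y hy, hyx]
      · exact fun h => absurd hx h
    rw [hKδ, Pi.smul_apply, hδ' y hy, if_neg hxy.symm, smul_zero]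
  obtain ⟨p, hp, hp1, hpK⟩ := hK.exists_zonal_polynomial (hunit e he) (hunit e' he')
    (by simpa using hee')
  -- Here p(1) = 2 K(e, e) = 2 |Y|.
  have hp0 : p ≠ 0 := by
    rintro rfl
    rw [Polynomial.eval_zero, hK.apply_self hd (hY.1 he), ← hcard] at hp1
    have hc : (Y.card : ℂ) ≠ 0 := by exact_mod_cast hne.card_pos.ne'
    exact mul_ne_zero two_ne_zero hc hp1.symm
  classical
  have hsub : (fun r : ℝ => (r : ℂ)) '' degreeSet (Y : Set (CSpace d)) ⊆
      (insert 0 p.roots.toFinset : Finset ℂ) := by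
    rintro _ ⟨_, ⟨x, hx, y, hy, hxy, rfl⟩, rfl⟩
    by_cases h : (inner ℂ x y : ℂ) = 0
    · simp [h]
    · have := hpK x y (hunit x hx) (hunit y hy) h (norm_inner_lt_one hY hx hy hxy)
        (hK0 x hx y hy hxy)
      simp only [Finset.coe_insert, Set.mem_insert_iff, Finset.mem_coe, Multiset.mem_toFinset,
        Polynomial.mem_roots hp0, Polynomial.IsRoot.def]
      exact Or.inr this
  rw [← Complex.ofReal_injective.encard_image]
  refine (Set.encard_le_encard hsub).trans ?_
  rw [Set.encard_coe_eq_coe_finsetCard]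
  have h1 := Finset.card_insert_le (0 : ℂ) p.roots.toFinset
  have h2 := p.roots.toFinset_card_le
  have h3 := p.card_roots'
  exact_mod_cast by omega

/-- If |t| < m, multiply F_x by |x'^*y|² with x' in Y orthogonal to x, which kills the last point x,
and pad the degree with powers of y^*y. The result lies in V and vanishes on Y, yet is not the zero
function. -/
theorem le_card_of_isDesign [NeZero d] {m : ℕ} {t : Finset ℝ} {Y : Finset (CSpace d)}
    (hY : IsLineSet (Y : Set (CSpace d))) (h0 : (0 : ℝ) ∈ degreeSet (Y : Set (CSpace d)))
    (H : IsDesign (2 * m + 1) (Y : Set (CSpace d)))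
    (ht : degreeSet (Y : Set (CSpace d)) ⊆ insert 0 (t : Set ℝ)) : m ≤ t.card := by
  by_contra! hlt
  obtain ⟨x, hx, x', hx', -, hxx'⟩ := h0
  replace hxx' : (inner ℂ x x' : ℂ) = 0 := by simpa using hxx'
  have hx'x : (inner ℂ x' x : ℂ) = 0 := inner_eq_zero_symm.1 hxx'
  have hne : Y.Nonempty := ⟨x, hx⟩
  have hx1 : ‖x‖ = 1 := by simpa using hY.1 hx
  have hx'1 : ‖x'‖ = 1 := by simpa using hY.1 hx'
  obtain ⟨j, rfl⟩ : ∃ j, m = t.card + 1 + j := ⟨m - (t.card + 1), by omega⟩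
  set f : CSpace d → ℂ := annihilator t x * (fun y => ((‖inner ℂ x' y‖ ^ 2 : ℝ) : ℂ)) *
    (fun y : CSpace d => ((‖y‖ ^ 2 : ℝ) : ℂ)) ^ j with hf
  have hfm : f ∈ HomPoly d (t.card + 1 + j + 1) (t.card + 1 + j) := by
    have := mul_mem_homPoly (mul_mem_homPoly (annihilator_mem t x)
      (norm_inner_sq_mem_homPoly x')) (pow_mem_homPoly norm_sq_mem_homPoly j)
    convert this using 1
    exact congrArg₂ (HomPoly d) (by ring) (by ring)
  have hf0 : f = 0 := by
    refine congrArg Subtype.val (evalOn_injective_of_isDesign hne H (a₁ := ⟨f, hfm⟩) (a₂ := 0)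
      (funext fun y => ?_))
    change f y = 0
    by_cases hxy : x = y
    · rw [hf, ← hxy]
      simp [hx'x]
    · rw [hf, Pi.mul_apply, Pi.mul_apply, annihilator_eq_zero hY.1 ht hx y.2 hxy, zero_mul,
        zero_mul]
  -- The point y below has |x^*y|² = u and |x'^*y|² = 1 - u, so no factor of f vanishes there.
  obtain ⟨u, ⟨hu0, hu1⟩, hut⟩ : ∃ u ∈ Set.Ioo (0 : ℝ) 1, u ∉ t := by
    by_contra! h
    exact Set.Ioo_infinite (zero_lt_one' ℝ) (t.finite_toSet.subset h)
  set y : CSpace d := ((√u : ℝ) : ℂ) • x + ((√(1 - u) : ℝ) : ℂ) • x' with hy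
  have hxx : inner ℂ x x = (1 : ℂ) := by rw [inner_self_eq_norm_sq_to_K, hx1]; simp
  have hx'x' : inner ℂ x' x' = (1 : ℂ) := by rw [inner_self_eq_norm_sq_to_K, hx'1]; simp
  have hxy : inner ℂ x y = ((√u : ℝ) : ℂ) := by
    rw [hy, inner_add_right, inner_smul_right, inner_smul_right, hxx, hxx', mul_one, mul_zero,
      add_zero]
  have hx'y : inner ℂ x' y = ((√(1 - u) : ℝ) : ℂ) := by
    rw [hy, inner_add_right, inner_smul_right, inner_smul_right, hx'x', hx'x, mul_one, mul_zero,
      zero_add]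
  have hyn : ‖y‖ ^ 2 = 1 := by
    have h := norm_add_sq_eq_norm_sq_add_norm_sq_of_inner_eq_zero (𝕜 := ℂ)
      (((√u : ℝ) : ℂ) • x) (((√(1 - u) : ℝ) : ℂ) • x')
      (by rw [inner_smul_left, inner_smul_right, hxx', mul_zero, mul_zero])
    rw [norm_smul, norm_smul, hx1, hx'1, Complex.norm_real, Complex.norm_real, mul_one, mul_one,
      Real.norm_of_nonneg (Real.sqrt_nonneg _), Real.norm_of_nonneg (Real.sqrt_nonneg _),
      Real.mul_self_sqrt hu0.le, Real.mul_self_sqrt (by linarith)] at h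
    rw [hy, sq, h]; ring
  have hu' : √u ≠ 0 := (Real.sqrt_pos.2 hu0).ne'
  have hv' : √(1 - u) ≠ 0 := (Real.sqrt_pos.2 (by linarith)).ne'
  have hfy := congrFun hf0 y
  simp only [hf, Pi.mul_apply, Pi.pow_apply, annihilator_apply, hxy, hx'y, hyn, Pi.zero_apply,
    Complex.norm_real, Real.norm_of_nonneg (Real.sqrt_nonneg _), Real.sq_sqrt hu0.le,
    mul_one, mul_eq_zero, Complex.ofReal_eq_zero, Finset.prod_eq_zero_iff, sub_eq_zero, hu',
    false_or, pow_eq_zero_iff two_ne_zero, hv', or_false, Complex.ofReal_one, one_pow] at hfy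
  obtain ⟨α, hα, rfl⟩ := hfy
  exact hut hα

end ComplexLines

end

/-! ### The three implications. -/

open ComplexLines in
theorem mainTheorem1 (d s : ℕ) (hs : 1 ≤ s) (X : Set (ComplexLines.CSpace d))
    (hX : ComplexLines.IsLineSet X) (h0 : (0 : ℝ) ∈ ComplexLines.degreeSet X) :
    (ComplexLines.IsDistanceSet s X → ComplexLines.IsDesign (2 * s - 1) X →
      X.encard = (Module.finrank ℂ (ComplexLines.HomPoly d s (s - 1)) : ℕ∞)) ∧
    (ComplexLines.IsDistanceSet s X →
      X.encard = (Module.finrank ℂ (ComplexLines.HomPoly d s (s - 1)) : ℕ∞) →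
      ComplexLines.IsDesign (2 * s - 1) X) ∧
    (ComplexLines.IsDesign (2 * s - 1) X →
      X.encard = (Module.finrank ℂ (ComplexLines.HomPoly d s (s - 1)) : ℕ∞) →
      ComplexLines.IsDistanceSet s X) := by
  obtain ⟨m, rfl⟩ : ∃ m, s = m + 1 := ⟨s - 1, by omega⟩
  rw [show 2 * (m + 1) - 1 = 2 * m + 1 by omega, show m + 1 - 1 = m by omega]
  -- The degree 0 provides two orthogonal unit vectors.
  have hd : 2 ≤ d := by
    obtain ⟨x, hx, y, hy, -, hxy⟩ := h0
    exact two_le_of_orthogonal (by simpa using hX.1 hx) (by simpa using hX.1 hy)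
      (by simpa using hxy)
  have : NeZero d := ⟨by omega⟩
  have hne : X.Nonempty := by
    obtain ⟨x, hx, -⟩ := h0
    exact ⟨x, hx⟩
  refine ⟨fun ha hb => ?_, fun ha hc => ?_, fun hb hc => ?_⟩
  · lift X to Finset (CSpace d) using hb.1
    obtain ⟨t, ht, htX, ht1⟩ := exists_finset_of_encard_degreeSet hX h0 ha
    obtain rfl : t.card = m := by omega
    -- Injectivity gives dim V ≤ |X|, surjectivity the reverse.
    have h1 := LinearMap.finrank_le_finrank_of_injective (evalOn_injective_of_isDesign hne hb)
    have h2 := LinearMap.finrank_le_finrank_of_surjective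
      (evalOn_surjective_of_annihilator hX htX ht1)
    rw [Module.finrank_fintype_fun_eq_card, Fintype.card_coe] at h1 h2
    rw [Set.encard_coe_eq_coe_finsetCard, le_antisymm h2 h1]
  · lift X to Finset (CSpace d) using Set.finite_of_encard_eq_coe hc
    obtain ⟨t, ht, htX, ht1⟩ := exists_finset_of_encard_degreeSet hX h0 ha
    obtain rfl : t.card = m := by omega
    rw [Set.encard_coe_eq_coe_finsetCard] at hc
    exact isDesign_of_annihilator hd hne hX htX ht1 (by exact_mod_cast hc)
  · lift X to Finset (CSpace d) using hb.1
    rw [Set.encard_coe_eq_coe_finsetCard] at hc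
    have hle := encard_degreeSet_le_of_isDesign hX h0 hb hd (by exact_mod_cast hc)
    obtain ⟨q, hq⟩ := ENat.ne_top_iff_exists.1 (ne_top_of_le_ne_top (ENat.natCast_ne_top _) hle)
    obtain ⟨t, ht, htX, -⟩ := exists_finset_of_encard_degreeSet hX h0 hq.symm
    have := le_card_of_isDesign hX h0 hb htX
    rw [IsDistanceSet, ← hq]
    rw [← hq] at hle
    have hle' : q ≤ m + 1 := by exact_mod_cast hle
    exact congrArg _ (by omega)
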